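/- Let $X$ be a real or complex Banach space that contains asymptotically isometric copies of $\ell_1$, i.e. such that at least one of the following (equivalent) conditions holds: (A1) there exist a null sequence $(\varepsilon_n)$ of positive numbers less than one and a sequence $(x_n)$ in $X$ such that $\sum_{n=1}^m (1-\varepsilon_n)|a_n| \le \left\|\sum_{n=1}^m a_n x_n\right\| \le \sum_{n=1}^m |a_n|$ for each finite sequence $(a_n)_{n=1}^m$ of scalars; (A2) there exist a null sequence $(\varepsilon_n)$ of positive numbers and a sequence $(x_n)$ in $X$ such that $\sum_{n=1}^m |a_n| \le \left\|\sum_{n=1}^m a_n x_n\right\| \le \sum_{n=1}^m (1+\varepsilon_n)|a_n|$ for each finite sequence $(a_n)_{n=1}^m$ of scalars; (A3) there exist a null sequence $(\varepsilon_n)$ of positive numbers and a sequence $(x_n)$ in $X$ such that $\sum_{n=k}^m |a_n| \le \left\|\sum_{n=k}^m a_n x_n\right\| \le (1+\varepsilon_k)\sum_{n=k}^m |a_n|$ for each $k\in\mathbb N$ and each finite sequence $(a_n)_{n=k}^m$ of scalars. Then there exist a nonempty convex subset $K$ of the dual space $X^*$ that is compact in the weak topology $\sigma(X^*,X^{**})$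 and an isometry $T\colon K\to K$ (that is, $\|Tf-Tg\|=\|f-g\|$ for all $f,g\in K$, with $T$ not required to be onto) without a fixed point. -/

import Mathlib

open Filter Topology

/-- There are a null sequence `ε` in `(0, 1)` and a sequence `x` in `X` such that
`∑ (1 - ε n) |a n| ≤ ‖∑ a n x n‖ ≤ ∑ |a n|` for all finite sequences of scalars. -/
def AsympIsomEllOneLower (𝕜 X : Type*) [RCLike 𝕜] [NormedAddCommGroup X] [NormedSpace 𝕜 X] :
    Prop :=
  ∃ (ε : ℕ → ℝ) (x : ℕ → X),
    (∀ n, 0 < ε n ∧ ε n < 1) ∧ Tendsto ε atTop (𝓝 0) ∧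
    ∀ (m : ℕ) (a : ℕ → 𝕜),
      ∑ n ∈ Finset.range m, (1 - ε n) * ‖a n‖ ≤ ‖∑ n ∈ Finset.range m, a n • x n‖ ∧
      ‖∑ n ∈ Finset.range m, a n • x n‖ ≤ ∑ n ∈ Finset.range m, ‖a n‖

/-- There are a null sequence `ε` of positive reals and a sequence `x` in `X` such that
`∑ |a n| ≤ ‖∑ a n x n‖ ≤ ∑ (1 + ε n) |a n|` for all finite sequences of scalars. -/
def AsympIsomEllOneUpper (𝕜 X : Type*) [RCLike 𝕜] [NormedAddCommGroup X] [NormedSpace 𝕜 X] :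
    Prop :=
  ∃ (ε : ℕ → ℝ) (x : ℕ → X),
    (∀ n, 0 < ε n) ∧ Tendsto ε atTop (𝓝 0) ∧
    ∀ (m : ℕ) (a : ℕ → 𝕜),
      ∑ n ∈ Finset.range m, ‖a n‖ ≤ ‖∑ n ∈ Finset.range m, a n • x n‖ ∧
      ‖∑ n ∈ Finset.range m, a n • x n‖ ≤ ∑ n ∈ Finset.range m, (1 + ε n) * ‖a n‖

/-- There are a null sequence `ε` of positive reals and a sequence `x` in `X` such that
`∑ |a n| ≤ ‖∑ a n x n‖ ≤ (1 + ε k) ∑ |a n|`, the sums being over `k ≤ n < m`,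
for all `k` and all finite sequences of scalars. -/
def AsympIsomEllOneTail (𝕜 X : Type*) [RCLike 𝕜] [NormedAddCommGroup X] [NormedSpace 𝕜 X] :
    Prop :=
  ∃ (ε : ℕ → ℝ) (x : ℕ → X),
    (∀ n, 0 < ε n) ∧ Tendsto ε atTop (𝓝 0) ∧
    ∀ (k m : ℕ) (a : ℕ → 𝕜),
      ∑ n ∈ Finset.Ico k m, ‖a n‖ ≤ ‖∑ n ∈ Finset.Ico k m, a n • x n‖ ∧
      ‖∑ n ∈ Finset.Ico k m, a n • x n‖ ≤ (1 + ε k) * ∑ n ∈ Finset.Ico k m, ‖a n‖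

/-- `X` contains asymptotically isometric copies of `ℓ₁`: it satisfies one of the three
(equivalent) conditions above. -/
def ContainsAsympIsomEllOne (𝕜 X : Type*) [RCLike 𝕜] [NormedAddCommGroup X] [NormedSpace 𝕜 X] :
    Prop :=
  AsympIsomEllOneLower 𝕜 X ∨ AsympIsomEllOneUpper 𝕜 X ∨ AsympIsomEllOneTail 𝕜 X

/-- `K ⊆ E` is compact in the weak topology `σ(E, E*)` of `E`. -/
def IsWeaklyCompact (𝕜 : Type*) {E : Type*} [RCLike 𝕜] [NormedAddCommGroup E] [NormedSpace 𝕜 E]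
    (K : Set E) : Prop :=
  IsCompact (toWeakSpace 𝕜 E '' K)

/-!
The dual `X*` contains an isometric copy of the real space `L₁` of a suitable probability space, and
`L₁` contains a weakly compact convex set with a fixed point free isometry; both can be carried over
to `X*`.

**The fixed point free isometry.** Let `P` be the law of an i.i.d. sequence of uniform variables on
`[0, 1)`, and let `K` be the set of `f ∈ L₁(P)` with `0 ≤ f ≤ 1` and `∫ f = 1/2`. It is bounded,
closed and convex already in the Hilbert space `L₂(P)`, hence weakly compact there and, by continuity
of the inclusion, in `L₁(P)` (`isWeaklyCompact_halfMassSlice`). Put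
`T f (ω₀, ω₁, ω₂, …) = 1` if `ω₀ < f (ω₁, ω₂, …)` and `0` otherwise. In other words, `T f` is the
indicator of the subgraph of `f`, carried to the sequence space by the identification of
`[0, 1) × [0, 1)^ℕ` with `[0, 1)^ℕ`. The `L₁` distance of two functions is the measure of the
symmetric difference of their subgraphs, so `T` is an isometry (`lintegral_edist_subgraphIndicator`). A fixed
point takes only the values `0` and `1`, and is then invariant under the shift; by Kolmogorov's
zero-one law the shift is ergodic (`ergodic_shift_infinitePi`), so the fixed point is constant, which
contradicts `∫ f = 1/2` (`not_ae_eq_subgraphIndicator`).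

**The copy of `L₁` in `X*`.** After rescaling there are `x n ∈ X` with
`∑ |a n| ≤ ‖∑ a n x n‖` and `‖x n‖ → 1` (`ContainsAsympIsomEllOne.exists_seq`). By Hahn-Banach every
sequence of signs `s` is `n ↦ φ (x n)` for some `φ` in the unit ball of `X*`. Choose measurable sets
`A n` which run infinitely often close to each measurable set, and let `g n = ±1` on `A n` and its
complement. For each `N` there is a simple function `Φ N` into the unit ball of `X*` with
`Φ N ω (x n) = g n ω` for `n < N`, and the functional `∫ f Φ N` has norm at most `‖f‖₁`. A weak-star
limit along an ultrafilter yields a linear contraction `L : L₁ → X*` with `L f (x n) = ∫ f g n`. Since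
`‖x n‖ → 1` and the `g n` come close to the sign of `f` infinitely often, `‖L f‖ ≥ ‖f‖₁`
(`exists_linearIsometry_lpOne_strongDual`).
-/

open MeasureTheory ProbabilityTheory
open scoped ENNReal symmDiff

/-! ### Weak compactness -/

/-- Reflexivity of Hilbert spaces, in the form in which it provides weakly compact sets. -/
theorem isWeaklyCompact_of_isClosed_of_convex_of_isBounded {H : Type*} [NormedAddCommGroup H]
    [InnerProductSpace ℝ H] [CompleteSpace H] {C : Set H} (hclosed : IsClosed C)
    (hconv : Convex ℝ C) (hbdd : Bornology.IsBounded C) : IsWeaklyCompact ℝ C := by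
  have hsurj : Function.Surjective (NormedSpace.inclusionInDoubleDualWeak ℝ H) := by
    intro φ
    let ψ : StrongDual ℝ H := LinearMap.mkContinuous
      { toFun := fun y => φ (InnerProductSpace.toDual ℝ H y)
        map_add' := fun y z => by simp
        map_smul' := fun c y => by simp }
      ‖WeakDual.toStrongDual φ‖ fun y => by
        simpa using (WeakDual.toStrongDual φ).le_opNorm (InnerProductSpace.toDual ℝ H y)
    refine ⟨toWeakSpace ℝ H ((InnerProductSpace.toDual ℝ H).symm ψ), ?_⟩
    refine DFunLike.ext _ _ fun l => ?_
    obtain ⟨y, rfl⟩ := (InnerProductSpace.toDual ℝ H).surjective l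
    change inner ℝ y ((InnerProductSpace.toDual ℝ H).symm ψ) = _
    rw [real_inner_comm, InnerProductSpace.toDual_symm_apply]
    rfl
  have h := NormedSpace.isCompact_closure_of_isBounded ℝ H (toWeakSpace ℝ H '' C)
    (by rwa [Set.preimage_image_eq _ (toWeakSpace ℝ H).injective])
    (by rw [hsurj.range_eq]; exact Set.subset_univ _)
  rwa [← hconv.toWeakSpace_closure ℝ, hclosed.closure_eq] at h

/-- Real-linear continuous maps preserve weak compactness even when the target carries the weak
topology of its `𝕜`-structure: real and imaginary parts of a `𝕜`-linear functional are real functionals. -/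
theorem IsWeaklyCompact.image {𝕜 E F : Type*} [RCLike 𝕜] [NormedAddCommGroup E] [NormedSpace ℝ E]
    [NormedAddCommGroup F] [NormedSpace 𝕜 F] [NormedSpace ℝ F] [IsScalarTower ℝ 𝕜 F]
    {C : Set E} (hC : IsWeaklyCompact ℝ C) (J : E →L[ℝ] F) : IsWeaklyCompact 𝕜 (J '' C) := by
  have hcont : Continuous fun z : WeakSpace ℝ E =>
      toWeakSpace 𝕜 F (J ((toWeakSpace ℝ E).symm z)) := by
    refine WeakBilin.continuous_of_continuous_eval _ fun l => ?_
    have key (m : StrongDual ℝ E) : Continuous fun z : WeakSpace ℝ E =>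
        m ((toWeakSpace ℝ E).symm z) := WeakBilin.eval_continuous (topDualPairing ℝ E).flip m
    have h1 := key ((RCLike.reCLM.comp (l.restrictScalars ℝ)).comp J)
    have h2 := key ((RCLike.imCLM.comp (l.restrictScalars ℝ)).comp J)
    have h3 : Continuous fun z : WeakSpace ℝ E =>
        l (J ((toWeakSpace ℝ E).symm z)) := by
      have := (RCLike.continuous_ofReal (K := 𝕜).comp h1).add
        ((RCLike.continuous_ofReal (K := 𝕜).comp h2).mul
          (continuous_const (y := (RCLike.I : 𝕜))))
      refine this.congr fun z => ?_
      exact RCLike.re_add_im _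
    exact h3
  have := IsCompact.image hC hcont
  rw [Set.image_image] at this
  rw [IsWeaklyCompact, Set.image_image]
  simpa using this

/-! ### The Bernoulli shift -/

section Shift

variable {S : Type*} [MeasurableSpace S] (ν : Measure S) [IsProbabilityMeasure ν]

theorem measurePreserving_cons_infinitePi :
    MeasurePreserving (fun p : S × (ℕ → S) => fun n : ℕ => Nat.casesOn n p.1 p.2)
      (ν.prod (Measure.infinitePi fun _ : ℕ => ν)) (Measure.infinitePi fun _ : ℕ => ν) := by
  classical
  have hm : Measurable fun p : S × (ℕ → S) => fun n : ℕ => (Nat.casesOn n p.1 p.2 : S) := by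
    refine measurable_pi_iff.2 fun n => ?_
    cases n with
    | zero => exact measurable_fst
    | succ n => exact (measurable_pi_apply n).comp measurable_snd
  refine ⟨hm, Measure.eq_infinitePi _ fun s t ht => ?_⟩
  obtain ⟨n, hn⟩ := s.exists_nat_subset_range
  -- Enlarge the set of constrained coordinates to an initial segment of `ℕ`.
  let t' : ℕ → Set S := fun i => if i ∈ s then t i else Set.univ
  have ht' (i) : MeasurableSet (t' i) := by
    simp only [t']; split_ifs
    exacts [ht i, .univ]
  have hs : Set.pi (s : Set ℕ) t = Set.pi (Finset.range (n + 1) : Set ℕ) t' := by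
    ext ω
    simp only [Set.mem_pi, Finset.mem_coe, t']
    refine ⟨fun h i _ => ?_, fun h i hi => ?_⟩
    · split_ifs with hi
      exacts [h i hi, trivial]
    · simpa [hi] using h i (Finset.mem_range.2 (by have := Finset.mem_range.1 (hn hi); omega))
  have hp : (fun p : S × (ℕ → S) => fun n : ℕ => (Nat.casesOn n p.1 p.2 : S)) ⁻¹'
      (Set.pi (Finset.range (n + 1) : Set ℕ) t') =
      t' 0 ×ˢ Set.pi (Finset.range n : Set ℕ) fun i => t' (i + 1) := by
    ext p
    simp only [Set.mem_preimage, Set.mem_pi, Finset.mem_coe, Finset.mem_range, Set.mem_prod]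
    refine ⟨fun h => ⟨h 0 (by omega), fun i hi => h (i + 1) (by omega)⟩, fun h i hi => ?_⟩
    cases i with
    | zero => exact h.1
    | succ i => exact h.2 i (by omega)
  rw [hs, Measure.map_apply hm (.pi (Set.to_countable _) fun i _ => ht' i), hp, Measure.prod_prod,
    Measure.infinitePi_pi _ (fun i _ => ht' (i + 1)), mul_comm,
    ← Finset.prod_range_succ' (fun i => ν (t' i)), ← Finset.prod_subset
      (hn.trans (Finset.range_mono n.le_succ)) (fun i _ hi => by simp [t', hi])]
  exact Finset.prod_congr rfl fun i hi => by simp [t', hi]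

theorem measurePreserving_head_shift_infinitePi :
    MeasurePreserving (fun ω : ℕ → S => (ω 0, fun n => ω (n + 1)))
      (Measure.infinitePi fun _ : ℕ => ν) (ν.prod (Measure.infinitePi fun _ : ℕ => ν)) := by
  have hm : Measurable fun ω : ℕ → S => (ω 0, fun n => ω (n + 1)) := by fun_prop
  have hc := measurePreserving_cons_infinitePi ν
  refine ⟨hm, ?_⟩
  conv_lhs => rw [← hc.map_eq]
  rw [Measure.map_map hm hc.measurable]
  exact Measure.map_id

/-- The Bernoulli shift is ergodic: an invariant set depends only on the coordinates from `n` on, for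
every `n`, so Kolmogorov's zero-one law applies. -/
theorem ergodic_shift_infinitePi :
    Ergodic (fun ω : ℕ → S => fun n => ω (n + 1)) (Measure.infinitePi fun _ : ℕ => ν) := by
  refine { (measurePreserving_snd.comp (measurePreserving_head_shift_infinitePi ν) :) with
    aeconst_set := fun {A} hA hinv => ?_ }
  have hiter (n : ℕ) : (fun ω : ℕ → S => fun k => ω (k + n)) ⁻¹' A = A := by
    induction n with
    | zero => rfl
    | succ n ih =>
      conv_rhs => rw [← ih, ← hinv]
      ext ω
      simp only [Set.mem_preimage]
      simp only [Nat.add_assoc, Nat.add_comm 1 n]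
  have htail : MeasurableSet[limsup
      (fun n => MeasurableSpace.comap (fun ω : ℕ → S => ω n) inferInstance) atTop] A := by
    rw [limsup_eq_iInf_iSup_of_nat, MeasurableSpace.measurableSet_iInf]
    intro n
    conv => rw [← hiter n]
    refine @measurableSet_preimage _ _ (_) _ _ _ ?_ hA
    refine @measurable_pi_lambda _ _ _ (_) _ _ fun k => ?_
    refine Measurable.mono (comap_measurable _) ?_ le_rfl
    exact le_iSup₂_of_le (k + n) (Nat.le_add_left _ _) le_rfl
  have hind : iIndepFun (fun n (ω : ℕ → S) => ω n) (Measure.infinitePi fun _ : ℕ => ν) :=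
    iIndepFun_infinitePi (X := fun _ x => x) fun _ => measurable_id
  rcases measure_zero_or_one_of_measurableSet_limsup_atTop
    (fun n => (measurable_pi_apply n).comap_le) hind htail with h | h
  · exact (eventuallyConst_set.2 (Or.inr (measure_eq_zero_iff_ae_notMem.1 h)))
  · exact (eventuallyConst_set.2 (Or.inl ((prob_compl_eq_zero_iff hA).2 h)))

end Shift

/-! ### A weakly compact convex set in `L₁` -/

/-- The inclusion of `L₂` into `L₁` for a probability measure. -/
noncomputable def lpTwoToLpOne {Ω : Type*} [MeasurableSpace Ω] (P : Measure Ω)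
    [IsProbabilityMeasure P] : Lp ℝ 2 P →L[ℝ] Lp ℝ 1 P :=
  LinearMap.mkContinuous
    { toFun := fun f => ((Lp.memLp f).mono_exponent one_le_two).toLp f
      map_add' := fun f g => by
        rw [← MemLp.toLp_add]
        exact MemLp.toLp_congr _ _ (Lp.coeFn_add f g)
      map_smul' := fun c f => by
        rw [RingHom.id_apply, ← MemLp.toLp_const_smul]
        exact MemLp.toLp_congr _ _ (Lp.coeFn_smul c f) }
    1 fun f => by
      rw [one_mul]
      change ‖((Lp.memLp f).mono_exponent one_le_two).toLp f‖ ≤ _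
      rw [Lp.norm_toLp _ ((Lp.memLp f).mono_exponent one_le_two), Lp.norm_def]
      exact ENNReal.toReal_mono (Lp.eLpNorm_ne_top f)
        (eLpNorm_le_eLpNorm_of_exponent_le one_le_two (Lp.aestronglyMeasurable f))

theorem lpTwoToLpOne_ae_eq {Ω : Type*} [MeasurableSpace Ω] (P : Measure Ω)
    [IsProbabilityMeasure P] (f : Lp ℝ 2 P) : lpTwoToLpOne P f =ᵐ[P] f :=
  ((Lp.memLp f).mono_exponent one_le_two).coeFn_toLp

/-- The functions in `Lᵖ` with values in `[0, 1]` and integral `1 / 2`. As a set of functions it does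
not depend on `p`; `p` selects the norm. -/
def halfMassSlice {Ω : Type*} [MeasurableSpace Ω] (P : Measure Ω) (p : ℝ≥0∞) : Set (Lp ℝ p P) :=
  {f | (∀ᵐ ω ∂P, 0 ≤ f ω ∧ f ω ≤ 1) ∧ ∫ ω, f ω ∂P = 1 / 2}

section HalfMassSlice

variable {Ω : Type*} [MeasurableSpace Ω] (P : Measure Ω) [IsProbabilityMeasure P]

theorem convex_halfMassSlice (p : ℝ≥0∞) [hp : Fact (1 ≤ p)] : Convex ℝ (halfMassSlice P p) := by
  intro f hf g hg a b ha hb hab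
  have hadd := Lp.coeFn_add (a • f) (b • g)
  have hsf := Lp.coeFn_smul a f
  have hsg := Lp.coeFn_smul b g
  have hae : ((a • f + b • g : Lp ℝ p P) : Ω → ℝ) =ᵐ[P] fun ω => a * f ω + b * g ω := by
    filter_upwards [hadd, hsf, hsg] with ω h1 h2 h3
    rw [h1, Pi.add_apply, h2, h3, Pi.smul_apply, Pi.smul_apply, smul_eq_mul, smul_eq_mul]
  refine ⟨?_, ?_⟩
  · filter_upwards [hf.1, hg.1, hae] with ω h1 h2 h
    rw [h]
    constructor
    · have := mul_nonneg ha h1.1; have := mul_nonneg hb h2.1; linarith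
    · have := mul_le_mul_of_nonneg_left h1.2 ha
      have := mul_le_mul_of_nonneg_left h2.2 hb; linarith
  · have hfi : Integrable f P := (Lp.memLp f).integrable hp.out
    have hgi : Integrable g P := (Lp.memLp g).integrable hp.out
    rw [integral_congr_ae hae, integral_add (hfi.const_mul a) (hgi.const_mul b),
      integral_const_mul, integral_const_mul, hf.2, hg.2, ← add_mul, hab, one_mul]

theorem nonempty_halfMassSlice (p : ℝ≥0∞) : (halfMassSlice P p).Nonempty := by
  have h : (memLp_const (1 / 2 : ℝ) : MemLp _ p P).toLp =ᵐ[P] fun _ => (1 / 2 : ℝ) :=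
    MemLp.coeFn_toLp _
  refine ⟨(memLp_const (1 / 2 : ℝ)).toLp, ?_, ?_⟩
  · filter_upwards [h] with ω hω
    rw [hω]; norm_num
  · rw [integral_congr_ae h]; simp

theorem isClosed_halfMassSlice_two : IsClosed (halfMassSlice P 2) := by
  have hone := Lp.coeFn_const (p := 2) (μ := P) (1 : ℝ)
  have h1 : halfMassSlice P 2 = Set.Icc 0 (Lp.const 2 P (1 : ℝ)) ∩
      (fun f => ∫ ω, lpTwoToLpOne P f ω ∂P) ⁻¹' {1 / 2} := by
    ext f
    simp only [halfMassSlice, Set.mem_ofPred_eq, Set.mem_inter_iff, Set.mem_Icc, Set.mem_preimage,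
      Set.mem_singleton_iff, integral_congr_ae (lpTwoToLpOne_ae_eq P f), eventually_and]
    rw [← Lp.coeFn_nonneg, ← Lp.coeFn_le]
    refine and_congr_left' (and_congr Iff.rfl (eventually_congr ?_))
    filter_upwards [hone] with ω h
    rw [h]; rfl
  rw [h1]
  exact isClosed_Icc.inter (isClosed_singleton.preimage
    (continuous_integral.comp (lpTwoToLpOne P).continuous))

theorem isBounded_halfMassSlice_two : Bornology.IsBounded (halfMassSlice P 2) :=
  isBounded_iff_forall_norm_le.2 ⟨_, fun f hf => Lp.norm_le_of_ae_bound zero_le_one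
    (hf.1.mono fun ω h => by rw [Real.norm_eq_abs, abs_of_nonneg h.1]; exact h.2)⟩

theorem image_lpTwoToLpOne_halfMassSlice :
    lpTwoToLpOne P '' halfMassSlice P 2 = halfMassSlice P 1 := by
  ext g
  constructor
  · rintro ⟨f, hf, rfl⟩
    have h := lpTwoToLpOne_ae_eq P f
    refine ⟨?_, by rw [integral_congr_ae h]; exact hf.2⟩
    filter_upwards [hf.1, h] with ω h1 h2
    rwa [h2]
  · intro hg
    have hmem : MemLp g 2 P := MemLp.of_bound (Lp.aestronglyMeasurable g) 1
      (hg.1.mono fun ω h => by rw [Real.norm_eq_abs, abs_of_nonneg h.1]; exact h.2)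
    have h := hmem.coeFn_toLp
    refine ⟨hmem.toLp g, ⟨?_, by rw [integral_congr_ae h]; exact hg.2⟩,
      Lp.ext ((lpTwoToLpOne_ae_eq P _).trans h)⟩
    filter_upwards [hg.1, h] with ω h1 h2
    rwa [h2]

theorem isWeaklyCompact_halfMassSlice : IsWeaklyCompact ℝ (halfMassSlice P 1) := by
  rw [← image_lpTwoToLpOne_halfMassSlice]
  exact (isWeaklyCompact_of_isClosed_of_convex_of_isBounded (isClosed_halfMassSlice_two P)
    (convex_halfMassSlice P 2) (isBounded_halfMassSlice_two P)).image _

end HalfMassSlice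

/-! ### The subgraph isometry of `L₁` -/

/-- The uniform distribution on `[0, 1)`, as a measure on `ℝ`. -/
noncomputable def unitLaw : Measure ℝ := volume.restrict (Set.Ico 0 1)

instance : IsProbabilityMeasure unitLaw := ⟨by simp [unitLaw]⟩

theorem ae_unitLaw : ∀ᵐ u ∂unitLaw, 0 ≤ u ∧ u < 1 :=
  ae_restrict_mem measurableSet_Ico

/-- The indicator of `{ω | U ω < f (σ ω)}`, the preimage under `(U, σ)` of the region below the graph
of `f`. -/
noncomputable def subgraphIndicator {Ω : Type*} (U : Ω → ℝ) (σ : Ω → Ω) (f : Ω → ℝ) : Ω → ℝ :=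
  {ω | U ω < f (σ ω)}.indicator 1

theorem subgraphIndicator_mem_Icc {Ω : Type*} (U : Ω → ℝ) (σ : Ω → Ω) (f : Ω → ℝ) (ω : Ω) :
    0 ≤ subgraphIndicator U σ f ω ∧ subgraphIndicator U σ f ω ≤ 1 := by
  unfold subgraphIndicator Set.indicator
  split_ifs <;> simp

theorem lintegral_edist_indicator_Iio {a b : ℝ} (ha : 0 ≤ a ∧ a ≤ 1) (hb : 0 ≤ b ∧ b ≤ 1) :
    ∫⁻ u, edist ((Set.Iio a).indicator (1 : ℝ → ℝ) u) ((Set.Iio b).indicator 1 u) ∂unitLaw =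
      edist a b := by
  wlog hab : a ≤ b generalizing a b
  · simpa only [edist_comm] using this hb ha (le_of_not_ge hab)
  have h (u : ℝ) : edist ((Set.Iio a).indicator (1 : ℝ → ℝ) u) ((Set.Iio b).indicator 1 u) =
      (Set.Ico a b).indicator 1 u := by
    by_cases h1 : u < a
    · simp [Set.indicator, h1, h1.trans_le hab, h1.not_ge]
    · by_cases h2 : u < b <;> simp [Set.indicator, h1, h2, not_lt.1 h1]
  simp_rw [h]
  rw [lintegral_indicator_one measurableSet_Ico, unitLaw, Measure.restrict_apply measurableSet_Ico,
    Set.inter_eq_left.2 (Set.Ico_subset_Ico ha.1 hb.2), Real.volume_Ico, edist_comm, edist_dist,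
    Real.dist_eq, abs_of_nonneg (sub_nonneg.2 hab)]

section Subgraph

variable {Ω : Type*} [MeasurableSpace Ω] {P : Measure Ω} [IsProbabilityMeasure P]
  {U : Ω → ℝ} {σ : Ω → Ω}

theorem measurable_subgraphIndicator (hU : Measurable U) (hσ : Measurable σ) {f : Ω → ℝ}
    (hf : Measurable f) : Measurable (subgraphIndicator U σ f) :=
  measurable_one.indicator (measurableSet_lt hU (hf.comp hσ))

/-- By Fubini, the measure of the symmetric difference of two subgraphs is the `L₁` distance of the
functions. -/
theorem lintegral_edist_subgraphIndicator
    (h : MeasurePreserving (fun ω => (U ω, σ ω)) P (unitLaw.prod P)) {f g : Ω → ℝ}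
    (hf : Measurable f) (hg : Measurable g) (hf01 : ∀ᵐ ω ∂P, 0 ≤ f ω ∧ f ω ≤ 1)
    (hg01 : ∀ᵐ ω ∂P, 0 ≤ g ω ∧ g ω ≤ 1) :
    ∫⁻ ω, edist (subgraphIndicator U σ f ω) (subgraphIndicator U σ g ω) ∂P =
      ∫⁻ ω, edist (f ω) (g ω) ∂P := by
  let F : ℝ × Ω → ℝ≥0∞ := fun p =>
    edist ((Set.Iio (f p.2)).indicator (1 : ℝ → ℝ) p.1) ((Set.Iio (g p.2)).indicator 1 p.1)
  have hind {k : Ω → ℝ} (hk : Measurable k) :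
      Measurable fun p : ℝ × Ω => (Set.Iio (k p.2)).indicator (1 : ℝ → ℝ) p.1 := by
    have : Measurable ({p : ℝ × Ω | p.1 < k p.2}.indicator (1 : ℝ × Ω → ℝ)) :=
      measurable_one.indicator (measurableSet_lt measurable_fst (hk.comp measurable_snd))
    exact this
  have hF : Measurable F := (hind hf).edist (hind hg)
  calc _ = ∫⁻ ω, F (U ω, σ ω) ∂P := rfl
    _ = ∫⁻ p, F p ∂(unitLaw.prod P) := h.lintegral_comp hF
    _ = ∫⁻ ω, ∫⁻ u, F (u, ω) ∂unitLaw ∂P := lintegral_prod_symm' _ hF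
    _ = _ := by
      refine lintegral_congr_ae ?_
      filter_upwards [hf01, hg01] with ω h1 h2
      exact lintegral_edist_indicator_Iio h1 h2

theorem integral_subgraphIndicator
    (h : MeasurePreserving (fun ω => (U ω, σ ω)) P (unitLaw.prod P)) {f : Ω → ℝ}
    (hf : Measurable f) (hf01 : ∀ᵐ ω ∂P, 0 ≤ f ω ∧ f ω ≤ 1) :
    ∫ ω, subgraphIndicator U σ f ω ∂P = ∫ ω, f ω ∂P := by
  have hU : Measurable U := measurable_fst.comp h.measurable
  have hσ : Measurable σ := measurable_snd.comp h.measurable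
  have hzero : ∀ᵐ ω ∂P, subgraphIndicator U σ 0 ω = 0 := by
    filter_upwards [(h.quasiMeasurePreserving).ae (Measure.quasiMeasurePreserving_fst.ae ae_unitLaw)]
      with ω hω
    exact Set.indicator_of_notMem (by simpa using hω.1) _
  rw [integral_eq_lintegral_of_nonneg_ae
      (Eventually.of_forall fun ω => (subgraphIndicator_mem_Icc U σ f ω).1)
      (measurable_subgraphIndicator hU hσ hf).aestronglyMeasurable,
    integral_eq_lintegral_of_nonneg_ae (hf01.mono fun ω h => h.1) hf.aestronglyMeasurable]
  congr 1
  -- Both integrals are `L₁` distances from `0`.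
  have := lintegral_edist_subgraphIndicator h hf (measurable_zero (α := ℝ)) hf01
    (Eventually.of_forall fun _ => by simp)
  refine (lintegral_congr_ae ?_).trans (this.trans (lintegral_congr_ae ?_))
  · filter_upwards [hzero] with ω hω
    rw [hω, edist_zero_right, Real.enorm_of_nonneg (subgraphIndicator_mem_Icc U σ f ω).1]
  · filter_upwards [hf01] with ω hω
    rw [Pi.zero_apply, edist_zero_right, Real.enorm_of_nonneg hω.1]

/-- A fixed point is the indicator of a set invariant under the ergodic map `σ`, so it is almost
surely `0` or almost surely `1`, and its integral is not `1 / 2`. -/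
theorem not_ae_eq_subgraphIndicator
    (h : MeasurePreserving (fun ω => (U ω, σ ω)) P (unitLaw.prod P)) (herg : Ergodic σ P)
    {f : Ω → ℝ} (hf : Measurable f) (hmass : ∫ ω, f ω ∂P = 1 / 2) :
    ¬ subgraphIndicator U σ f =ᵐ[P] f := by
  intro hfix
  have hval : ∀ᵐ ω ∂P, f ω = 0 ∨ f ω = 1 := by
    filter_upwards [hfix] with ω hω
    rw [← hω]
    unfold subgraphIndicator Set.indicator
    split_ifs <;> simp
  have hU := h.quasiMeasurePreserving.ae (Measure.quasiMeasurePreserving_fst.ae ae_unitLaw)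
  -- For `f (σ ω) ∈ {0, 1}` and `0 ≤ U ω < 1` the indicator of `U ω < f (σ ω)` is `f (σ ω)` itself.
  have hinv : f ∘ σ =ᵐ[P] f := by
    filter_upwards [hfix, herg.quasiMeasurePreserving.ae hval, hU] with ω h1 h2 h3
    rw [← h1, Function.comp_apply]
    rcases h2 with h2 | h2 <;> simp [subgraphIndicator, Set.indicator, h2, h3.1, h3.2]
  obtain ⟨c, hc⟩ := herg.ae_eq_const_of_ae_eq_comp₀ hf.nullMeasurable hinv
  have hc2 : c = 1 / 2 := by
    rw [integral_congr_ae hc] at hmass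
    simpa using hmass
  obtain ⟨ω, h1, h2⟩ := (hval.and hc).exists
  rw [h2, Function.const_apply, hc2] at h1
  norm_num at h1

end Subgraph

theorem exists_isometry_halfMassSlice {Ω : Type*} [MeasurableSpace Ω] {P : Measure Ω}
    [IsProbabilityMeasure P] {U : Ω → ℝ} {σ : Ω → Ω}
    (h : MeasurePreserving (fun ω => (U ω, σ ω)) P (unitLaw.prod P)) (herg : Ergodic σ P) :
    ∃ T : halfMassSlice P 1 → halfMassSlice P 1, Isometry T ∧ ∀ f, T f ≠ f := by
  have hU : Measurable U := measurable_fst.comp h.measurable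
  have hσ : Measurable σ := measurable_snd.comp h.measurable
  have hmeas (f : Lp ℝ 1 P) : Measurable f := (Lp.stronglyMeasurable f).measurable
  have hmem (f : Lp ℝ 1 P) : Integrable (subgraphIndicator U σ f) P :=
    .of_bound (measurable_subgraphIndicator hU hσ (hmeas f)).aestronglyMeasurable 1
      (Eventually.of_forall fun ω => by
        have := subgraphIndicator_mem_Icc U σ f ω
        rw [Real.norm_eq_abs, abs_of_nonneg this.1]; exact this.2)
  refine ⟨fun f => ⟨(hmem f).toL1 _, ?_, ?_⟩, fun f g => ?_, fun f hf => ?_⟩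
  · filter_upwards [(hmem f).coeFn_toL1] with ω hω
    rw [hω]
    exact subgraphIndicator_mem_Icc U σ f ω
  · rw [integral_congr_ae (hmem f).coeFn_toL1, integral_subgraphIndicator h (hmeas f) f.2.1]
    exact f.2.2
  · rw [Subtype.edist_eq, Subtype.edist_eq, Integrable.edist_toL1_toL1,
      lintegral_edist_subgraphIndicator h (hmeas f) (hmeas g) f.2.1 g.2.1,
      ← Integrable.edist_toL1_toL1 _ _ (L1.integrable_coeFn f.1) (L1.integrable_coeFn g.1),
      Integrable.toL1_coeFn, Integrable.toL1_coeFn]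
  · refine not_ae_eq_subgraphIndicator h herg (hmeas f) f.2.2 ?_
    have := (hmem f).coeFn_toL1
    rw [show (hmem f).toL1 _ = (f : Lp ℝ 1 P) from congrArg Subtype.val hf] at this
    exact this.symm

/-! ### Isometric copies of `L₁` in the dual -/

/-- The lower `ℓ₁`-estimate makes `x n ↦ s n` a well-defined functional of norm at most one on the
linear span of the `x n`; Hahn-Banach extends it. -/
theorem exists_strongDual_apply_eq {𝕜 X : Type*} [RCLike 𝕜] [NormedAddCommGroup X]
    [NormedSpace 𝕜 X] {x : ℕ → X}
    (hx : ∀ (m : ℕ) (a : ℕ → 𝕜),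
      ∑ n ∈ Finset.range m, ‖a n‖ ≤ ‖∑ n ∈ Finset.range m, a n • x n‖)
    {s : ℕ → 𝕜} (hs : ∀ n, ‖s n‖ ≤ 1) :
    ∃ φ : StrongDual 𝕜 X, ‖φ‖ ≤ 1 ∧ ∀ n, φ (x n) = s n := by
  let L : (ℕ →₀ 𝕜) →ₗ[𝕜] X := Finsupp.linearCombination 𝕜 x
  let S : (ℕ →₀ 𝕜) →ₗ[𝕜] 𝕜 := Finsupp.linearCombination 𝕜 s
  have hlow (a : ℕ →₀ 𝕜) : ∑ n ∈ a.support, ‖a n‖ ≤ ‖L a‖ := by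
    obtain ⟨m, hm⟩ := a.support.exists_nat_subset_range
    have h := hx m a
    rw [← Finset.sum_subset hm (fun n _ hn => by simp [Finsupp.notMem_support_iff.1 hn]),
      ← Finset.sum_subset hm (fun n _ hn => by simp [Finsupp.notMem_support_iff.1 hn])] at h
    rwa [show L a = _ from Finsupp.linearCombination_apply 𝕜 a]
  have hinj : Function.Injective L := by
    rw [← LinearMap.ker_eq_bot, LinearMap.ker_eq_bot']
    intro a ha
    have h := hlow a
    rw [ha, norm_zero] at h
    ext n
    by_contra hn
    have h1 := Finset.single_le_sum (f := fun n => ‖a n‖) (fun i _ => norm_nonneg _)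
      (Finsupp.mem_support_iff.2 hn)
    exact hn (norm_le_zero_iff.1 (h1.trans h))
  let e := LinearEquiv.ofInjective L hinj
  have hbound (y : LinearMap.range L) : ‖(S ∘ₗ e.symm.toLinearMap) y‖ ≤ 1 * ‖y‖ := by
    obtain ⟨a, rfl⟩ := e.surjective y
    rw [one_mul, LinearMap.comp_apply, LinearEquiv.coe_coe, e.symm_apply_apply]
    refine le_trans ?_ (hlow a)
    rw [show S a = _ from Finsupp.linearCombination_apply 𝕜 a]
    refine (norm_sum_le _ _).trans (Finset.sum_le_sum fun n _ => ?_)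
    rw [norm_smul]
    exact mul_le_of_le_one_right (norm_nonneg _) (hs n)
  obtain ⟨φ, hφ, hnorm⟩ := exists_extension_norm_eq (LinearMap.range L)
    ((S ∘ₗ e.symm.toLinearMap).mkContinuous 1 hbound)
  refine ⟨φ, hnorm ▸ LinearMap.mkContinuous_norm_le _ zero_le_one _, fun n => ?_⟩
  have h := hφ (e (Finsupp.single n 1))
  rw [LinearMap.mkContinuous_apply, LinearMap.comp_apply, LinearEquiv.coe_coe,
    e.symm_apply_apply] at h
  simpa [e, L, S] using h

/-- A countable measure-dense family, each member repeated infinitely often, so that the approximation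
of any set takes place at arbitrarily large indices. -/
theorem exists_seq_measurableSet_frequently_setIntegral_lt {Ω : Type*} [MeasurableSpace Ω]
    (μ : Measure Ω) [IsFiniteMeasure μ] [IsSeparable μ] :
    ∃ A : ℕ → Set Ω, (∀ n, MeasurableSet (A n)) ∧ ∀ f : Ω → ℝ, Integrable f μ →
      ∀ S, MeasurableSet S → ∀ δ > 0, ∃ᶠ n in atTop,
        |∫ ω in A n, f ω ∂μ - ∫ ω in S, f ω ∂μ| < δ := by
  obtain ⟨𝒜, hcount, hdense⟩ := exists_countable_measureDense μ
  obtain ⟨B, rfl⟩ := hcount.exists_eq_range hdense.nonempty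
  have hB (k) : MeasurableSet (B k) := hdense.measurable _ ⟨k, rfl⟩
  refine ⟨fun n => B n.unpair.1, fun n => hB _, fun f hf S hS δ hδ => ?_⟩
  obtain ⟨η, hη, hsmall⟩ := exists_pos_setLIntegral_lt_of_measure_lt
    (hf.hasFiniteIntegral.ne) (ENNReal.ofReal_pos.2 hδ).ne'
  obtain ⟨η', hη', hle⟩ : ∃ η' : ℝ, 0 < η' ∧ ENNReal.ofReal η' ≤ η := by
    rcases eq_or_ne η ∞ with rfl | h
    · exact ⟨1, one_pos, le_top⟩
    · exact ⟨η.toReal, ENNReal.toReal_pos hη.ne' h, ENNReal.ofReal_toReal_le⟩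
  obtain ⟨_, ⟨k, rfl⟩, hk⟩ := hdense.approx S hS (measure_ne_top _ _) η' hη'
  have hmain : |∫ ω in B k, f ω ∂μ - ∫ ω in S, f ω ∂μ| < δ := by
    have hdiff : ∫ ω in B k, f ω ∂μ - ∫ ω in S, f ω ∂μ =
        ∫ ω, (B k).indicator f ω - S.indicator f ω ∂μ := by
      rw [integral_sub (hf.indicator (hB k)) (hf.indicator hS), integral_indicator (hB k),
        integral_indicator hS]
    have hm : MeasurableSet (S ∆ B k) := hS.symmDiff (hB k)
    calc _ ≤ ∫ ω, ‖(B k).indicator f ω - S.indicator f ω‖ ∂μ := by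
          rw [hdiff, ← Real.norm_eq_abs]; exact norm_integral_le_integral_norm _
      _ = ∫ ω in S ∆ B k, ‖f ω‖ ∂μ := by
          rw [← integral_indicator hm]
          congr 1 with ω
          by_cases h1 : ω ∈ S <;> by_cases h2 : ω ∈ B k <;>
            simp [Set.indicator, Set.mem_symmDiff, h1, h2]
      _ = (∫⁻ ω in S ∆ B k, ‖f ω‖ₑ ∂μ).toReal :=
          integral_norm_eq_lintegral_enorm hf.1.restrict
      _ < δ := by
          have := hsmall _ (hk.trans_le hle)
          rw [← ENNReal.toReal_ofReal hδ.le]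
          exact (ENNReal.toReal_lt_toReal this.ne_top ENNReal.ofReal_ne_top).2 this
  -- `n.unpair.1 = k` for all `n = Nat.pair k N`, and these are at least `N`.
  refine frequently_atTop.2 fun N => ⟨Nat.pair k N, Nat.right_le_pair k N, ?_⟩
  simpa using hmain

/-- By Banach-Alaoglu, linear contractions into a dual space have a pointwise weak-star limit along an
ultrafilter, and it is again a linear contraction. -/
theorem exists_ultrafilter_limit {𝕜 X E : Type*} [RCLike 𝕜] [NormedAddCommGroup X]
    [NormedSpace 𝕜 X] [NormedAddCommGroup E] [NormedSpace ℝ E]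
    (J : ℕ → E →ₗ[ℝ] StrongDual 𝕜 X) (hJ : ∀ N f, ‖J N f‖ ≤ ‖f‖) :
    ∃ L : E →ₗ[ℝ] StrongDual 𝕜 X, (∀ f, ‖L f‖ ≤ ‖f‖) ∧
      ∀ f x, Tendsto (fun N => J N f x) (hyperfilter ℕ) (𝓝 (L f x)) := by
  have hlim (f : E) : ∃ φ : StrongDual 𝕜 X, ‖φ‖ ≤ ‖f‖ ∧
      ∀ x, Tendsto (fun N => J N f x) (hyperfilter ℕ) (𝓝 (φ x)) := by
    obtain ⟨ψ, hψ, hle⟩ := (WeakDual.isCompact_closedBall (𝕜 := 𝕜) (E := X) 0 ‖f‖).ultrafilter_le_nhds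
      ((hyperfilter ℕ : Ultrafilter ℕ).map fun N => StrongDual.toWeakDual (J N f)) (by
        rw [le_principal_iff]
        exact Eventually.of_forall (f := (hyperfilter ℕ : Filter ℕ)) fun N =>
          mem_closedBall_zero_iff.2 (hJ N f))
    refine ⟨WeakDual.toStrongDual ψ, mem_closedBall_zero_iff.1 hψ, fun x => ?_⟩
    exact ((WeakDual.eval_continuous x).tendsto ψ).comp hle
  choose L hL hLlim using hlim
  refine ⟨⟨⟨L, fun f g => ?_⟩, fun c f => ?_⟩, hL, hLlim⟩
  · ext x
    refine tendsto_nhds_unique (hLlim (f + g) x) ?_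
    simpa using (hLlim f x).add (hLlim g x)
  · ext x
    refine tendsto_nhds_unique (hLlim (c • f) x) ?_
    simpa using (hLlim f x).const_smul c

/-- If `X` contains an asymptotically isometric copy of `ℓ₁`, here with the lower estimate normalised,
then the real space `L₁(μ)` of a separable finite measure embeds isometrically into `X*`. -/
theorem exists_linearIsometry_lpOne_strongDual {𝕜 X : Type*} [RCLike 𝕜] [NormedAddCommGroup X]
    [NormedSpace 𝕜 X] {x : ℕ → X}
    (hx : ∀ (m : ℕ) (a : ℕ → 𝕜),
      ∑ n ∈ Finset.range m, ‖a n‖ ≤ ‖∑ n ∈ Finset.range m, a n • x n‖)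
    (hx1 : Tendsto (fun n => ‖x n‖) atTop (𝓝 1)) {Ω : Type*} [MeasurableSpace Ω]
    (μ : Measure Ω) [IsFiniteMeasure μ] [IsSeparable μ] :
    Nonempty (Lp ℝ 1 μ →ₗᵢ[ℝ] StrongDual 𝕜 X) := by
  classical
  obtain ⟨A, hA, hAdense⟩ := exists_seq_measurableSet_frequently_setIntegral_lt μ
  have hφ (s : ℕ → Bool) : ∃ φ : StrongDual 𝕜 X, ‖φ‖ ≤ 1 ∧ ∀ n, φ (x n) = if s n then 1 else -1 :=
    exists_strongDual_apply_eq hx fun n => by split_ifs <;> simp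
  choose φ hφ1 hφx using hφ
  -- `Φ N ω (x n)` is `1` on `A n` and `-1` off it, for `n < N`. Ignoring the later sets makes `Φ N`
  -- depend on finitely many bits, which gives measurability.
  let Φ : ℕ → Ω → StrongDual 𝕜 X := fun N ω => φ fun n => decide (n < N ∧ ω ∈ A n)
  have hΦmeas (N : ℕ) : StronglyMeasurable (Φ N) := by
    have hπ : Measurable fun ω (n : Fin N) => decide (ω ∈ A n) :=
      measurable_pi_lambda _ fun n => measurable_to_bool (by
        convert hA n using 1
        ext ω; simp)
    convert (StronglyMeasurable.of_discrete (f := fun p : Fin N → Bool =>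
      φ fun n => if h : n < N then p ⟨n, h⟩ else false)).comp_measurable hπ using 1
    ext1 ω
    refine congrArg φ (funext fun n => ?_)
    by_cases h : n < N <;> simp [h]
  have hint (N : ℕ) (f : Lp ℝ 1 μ) : Integrable (fun ω => f ω • Φ N ω) μ :=
    (L1.integrable_coeFn f).smul_bdd 1 (hΦmeas N).aestronglyMeasurable
      (Eventually.of_forall fun ω => hφ1 _)
  let J : ℕ → Lp ℝ 1 μ →ₗ[ℝ] StrongDual 𝕜 X := fun N =>
    { toFun := fun f => ∫ ω, f ω • Φ N ω ∂μ
      map_add' := fun f g => by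
        rw [← integral_add (hint N f) (hint N g)]
        refine integral_congr_ae ?_
        filter_upwards [Lp.coeFn_add f g] with ω hω
        rw [hω, Pi.add_apply]
        exact add_smul (f ω) (g ω) (Φ N ω)
      map_smul' := fun c f => by
        rw [RingHom.id_apply, ← integral_smul]
        refine integral_congr_ae ?_
        filter_upwards [Lp.coeFn_smul c f] with ω hω
        rw [hω, Pi.smul_apply, smul_assoc] }
  have hJ (N) (f : Lp ℝ 1 μ) : ‖J N f‖ ≤ ‖f‖ := by
    rw [L1.norm_eq_integral_norm]
    refine norm_integral_le_of_norm_le (L1.integrable_coeFn f).norm (Eventually.of_forall fun ω => ?_)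
    rw [norm_smul]
    exact mul_le_of_le_one_right (norm_nonneg _) (hφ1 _)
  obtain ⟨L, hL, hLlim⟩ := exists_ultrafilter_limit J hJ
  -- In the limit, `L f (x n)` is the integral of `f` against `1` on `A n` and `-1` off it.
  have hLx (f : Lp ℝ 1 μ) (n : ℕ) :
      L f (x n) = ((2 * ∫ ω in A n, f ω ∂μ - ∫ ω, f ω ∂μ : ℝ) : 𝕜) := by
    refine tendsto_nhds_unique (hLlim f (x n)) (tendsto_const_nhds.congr' ?_)
    have hev : ∀ᶠ N in (hyperfilter ℕ : Filter ℕ), n < N :=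
      (Nat.hyperfilter_le_atTop) (eventually_gt_atTop n)
    filter_upwards [hev] with N hN
    let ev : StrongDual 𝕜 X →L[ℝ] 𝕜 := (ContinuousLinearMap.apply 𝕜 𝕜 (x n)).restrictScalars ℝ
    have h1 : J N f (x n) = ∫ ω, ev (f ω • Φ N ω) ∂μ := (ev.integral_comp_comm (hint N f)).symm
    have hfi := L1.integrable_coeFn f
    rw [h1, ← integral_indicator (hA n), ← integral_const_mul,
      ← integral_sub ((hfi.indicator (hA n)).const_mul 2) hfi, ← integral_ofReal]
    congr 1 with ω
    have h2 : ev (f ω • Φ N ω) = f ω • (Φ N ω (x n)) := rfl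
    rw [h2, hφx, RCLike.real_smul_eq_coe_mul]
    by_cases h : ω ∈ A n
    · simp only [hN, h, and_self, decide_true, if_true, mul_one, Set.indicator_of_mem]
      push_cast
      ring
    · simp [h]
  refine ⟨⟨L, fun f => le_antisymm (hL f) ?_⟩⟩
  have hfi := L1.integrable_coeFn f
  -- Conversely, the norm of `f` is its integral against its sign, and `{0 ≤ f}` is approximated by
  -- the sets `A n` with `n` so large that `‖x n‖` is close to `1`.
  have hS : MeasurableSet {ω | 0 ≤ f ω} :=
    measurableSet_le measurable_const (Lp.stronglyMeasurable f).measurable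
  have hnorm : ‖f‖ = 2 * ∫ ω in {ω | 0 ≤ f ω}, f ω ∂μ - ∫ ω, f ω ∂μ := by
    rw [L1.norm_eq_integral_norm, ← integral_indicator hS, ← integral_const_mul,
      ← integral_sub ((hfi.indicator hS).const_mul 2) hfi]
    congr 1 with ω
    by_cases h : 0 ≤ f ω
    · simp [Set.indicator, h, abs_of_nonneg h]; ring
    · simp [Set.indicator, h, abs_of_neg (not_le.1 h)]
  refine le_of_forall_pos_le_add fun δ hδ => ?_
  have hlim : Tendsto (fun n => ‖L f‖ * ‖x n‖) atTop (𝓝 (‖L f‖ * 1)) := hx1.const_mul _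
  rw [mul_one] at hlim
  obtain ⟨n, hn1, hn2⟩ := ((hAdense f hfi _ hS (δ / 4) (by positivity)).and_eventually
    (hlim.eventually (gt_mem_nhds (show ‖L f‖ < ‖L f‖ + δ / 2 by linarith)))).exists
  have h1 := (L f).le_opNorm (x n)
  rw [hLx, RCLike.norm_ofReal] at h1
  have h2 := le_abs_self (2 * ∫ ω in A n, f ω ∂μ - ∫ ω, f ω ∂μ)
  have h3 := (abs_lt.1 hn1).1
  change ‖f‖ ≤ ‖L f‖ + δ
  linarith

/-- All three conditions provide, after rescaling by `(1 - ε n)⁻¹` in the first case, a sequence with an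
exact lower `ℓ₁`-estimate and norms tending to `1`. -/
theorem ContainsAsympIsomEllOne.exists_seq {𝕜 X : Type*} [RCLike 𝕜] [NormedAddCommGroup X]
    [NormedSpace 𝕜 X] (hX : ContainsAsympIsomEllOne 𝕜 X) :
    ∃ x : ℕ → X, (∀ (m : ℕ) (a : ℕ → 𝕜),
      ∑ n ∈ Finset.range m, ‖a n‖ ≤ ‖∑ n ∈ Finset.range m, a n • x n‖) ∧
      Tendsto (fun n => ‖x n‖) atTop (𝓝 1) := by
  have hone_le {x : ℕ → X} (hx : ∀ (m : ℕ) (a : ℕ → 𝕜),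
      ∑ n ∈ Finset.range m, ‖a n‖ ≤ ‖∑ n ∈ Finset.range m, a n • x n‖) (n : ℕ) : 1 ≤ ‖x n‖ := by
    simpa [Pi.single_apply, apply_ite norm] using hx (n + 1) (Pi.single n 1)
  have hsqueeze {x : ℕ → X} {ε : ℕ → ℝ} (hε : Tendsto ε atTop (𝓝 0))
      (hx : ∀ (m : ℕ) (a : ℕ → 𝕜),
        ∑ n ∈ Finset.range m, ‖a n‖ ≤ ‖∑ n ∈ Finset.range m, a n • x n‖)
      (hle : ∀ n, ‖x n‖ ≤ 1 + ε n) : Tendsto (fun n => ‖x n‖) atTop (𝓝 1) :=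
    tendsto_of_tendsto_of_tendsto_of_le_of_le tendsto_const_nhds
      (by simpa using hε.const_add 1) (hone_le hx) hle
  -- The single-term sums, `a = Pi.single n 1`, control `‖x n‖`.
  rcases hX with ⟨ε, x, hε, hε0, h⟩ | ⟨ε, x, -, hε0, h⟩ | ⟨ε, x, -, hε0, h⟩
  · have hpos (n) : 0 < 1 - ε n := sub_pos.2 (hε n).2
    have hlow (m : ℕ) (a : ℕ → 𝕜) : ∑ n ∈ Finset.range m, ‖a n‖ ≤
        ‖∑ n ∈ Finset.range m, a n • ((1 - ε n : ℝ) : 𝕜)⁻¹ • x n‖ := by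
      have := (h m fun n => a n * ((1 - ε n : ℝ) : 𝕜)⁻¹).1
      simp only [← smul_smul] at this
      refine le_of_eq_of_le (Finset.sum_congr rfl fun n _ => ?_) this
      rw [norm_mul, norm_inv, RCLike.norm_ofReal, abs_of_pos (hpos n)]
      field_simp [(hpos n).ne']
    refine ⟨_, hlow, tendsto_of_tendsto_of_tendsto_of_le_of_le tendsto_const_nhds
      (h := fun n => (1 - ε n)⁻¹) (by simpa using (hε0.const_sub 1).inv₀ (by simp))
      (hone_le hlow) fun n => ?_⟩
    have h1 : ‖x n‖ ≤ 1 := by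
      simpa [Pi.single_apply, apply_ite norm] using (h (n + 1) (Pi.single n 1)).2
    rw [norm_smul, norm_inv, RCLike.norm_ofReal, abs_of_pos (hpos n)]
    exact mul_le_of_le_one_right (inv_nonneg.2 (hpos n).le) h1
  · have hlow := fun m a => (h m a).1
    refine ⟨x, hlow, hsqueeze hε0 hlow fun n => ?_⟩
    simpa [Pi.single_apply, apply_ite norm] using (h (n + 1) (Pi.single n 1)).2
  · have hlow (m : ℕ) (a : ℕ → 𝕜) :
        ∑ n ∈ Finset.range m, ‖a n‖ ≤ ‖∑ n ∈ Finset.range m, a n • x n‖ := by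
      simpa only [Finset.range_eq_Ico] using (h 0 m a).1
    refine ⟨x, hlow, hsqueeze hε0 hlow fun n => ?_⟩
    simpa using (h n (n + 1) fun _ => 1).2

/-! ### The fixed point free isometry in the dual -/

theorem mainTheorem3 (𝕜 : Type*) [RCLike 𝕜] (X : Type*) [NormedAddCommGroup X]
    [NormedSpace 𝕜 X] [CompleteSpace X] (hX : ContainsAsympIsomEllOne 𝕜 X) :
    ∃ K : Set (StrongDual 𝕜 X), K.Nonempty ∧ Convex ℝ K ∧ IsWeaklyCompact 𝕜 K ∧
      ∃ T : K → K, Isometry T ∧ ∀ f : K, T f ≠ f := by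
  let P : Measure (ℕ → ℝ) := Measure.infinitePi fun _ => unitLaw
  obtain ⟨x, hx, hx1⟩ := hX.exists_seq
  obtain ⟨J⟩ := exists_linearIsometry_lpOne_strongDual hx hx1 P
  obtain ⟨T, hT, hfix⟩ := exists_isometry_halfMassSlice
    (measurePreserving_head_shift_infinitePi unitLaw) (ergodic_shift_infinitePi unitLaw)
  refine ⟨J '' halfMassSlice P 1, (nonempty_halfMassSlice P 1).image _,
    (convex_halfMassSlice P 1).linear_image J.toLinearMap,
    (isWeaklyCompact_halfMassSlice P).image J.toContinuousLinearMap, ?_⟩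
  let e : halfMassSlice P 1 ≃ᵢ J '' halfMassSlice P 1 :=
    ⟨Equiv.Set.image J _ J.injective, fun f g => J.isometry.edist_eq f g⟩
  refine ⟨fun f => e (T (e.symm f)), e.isometry.comp (hT.comp e.symm.isometry), fun f hf => ?_⟩
  exact hfix (e.symm f) (e.injective (hf.trans (e.apply_symm_apply f).symm))
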